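/- Let $\Gamma$ be a symmetric bimatrix game: a finite set $C$ of strategies, common to both players, and utility functions $u_1,u_2:C\times C\to\mathbb{R}$ with $u_1(s,t)=u_2(t,s)$ for all $s,t\in C$. A probability distribution $\pi$ on $C\times C$ is a *correlated equilibrium* of $\Gamma$ if for every function $f:C\to C$ $$\sum_{(s_1,s_2)\in C\times C}\bigl[u_1(f(s_1),s_2)-u_1(s_1,s_2)\bigr]\pi(s_1,s_2)\le 0 \quad\text{and}\quad \sum_{(s_1,s_2)\in C\times C}\bigl[u_2(s_1,f(s_2))-u_2(s_1,s_2)\bigr]\pi(s_1,s_2)\le 0 .$$ It is an *exchangeable equilibrium* of $\Gamma$ if it is a correlated equilibrium and is the distribution of a pair of random variables that is conditionally i.i.d., i.e. i.i.d. conditioned on some hidden random variable (with values in an arbitrary measurable space). An *$\infty$-exchangeable equilibrium* of $\Gamma$ is the distribution of an infinite sequence $X_1,X_2,X_3,\ldots$ of $C$-valued random variables that is exchangeable (its distribution is invariant under all permutations of finitely many indices) and such that the distribution of $(X_1,X_2)$ is a correlated equilibrium of $\Gamma$. **Corollary.** The distribution of two random variables $X_1,X_2$ with values in $C$ is an exchangeable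 equilibrium of $\Gamma$ if and only if it is the bivariate marginal distribution (the distribution of the first two coordinates) of an infinite sequence $X_1,X_2,X_3,\ldots$ which is an $\infty$-exchangeable equilibrium of $\Gamma$. The same equivalence holds if, in the definition of exchangeable equilibrium, "conditionally i.i.d." is replaced by "the matrix $(\pi(s,t))_{s,t\in C}$ lies in the convex hull of the matrices $(w(s)w(t))_{s,t\in C}$, where $w$ ranges over the probability distributions on $C$". -/

import Mathlib

open MeasureTheory ProbabilityTheory

universe u v

/-- A (finite) symmetric bimatrix game with common strategy set `C`: two utility functions
`u₁, u₂`, evaluated at `(strategy of player 1, strategy of player 2)`, with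
`u₁ (s, t) = u₂ (t, s)`. -/
structure SymmetricBimatrixGame (C : Type*) where
  /-- utility of player 1 -/
  u₁ : C → C → ℝ
  /-- utility of player 2 -/
  u₂ : C → C → ℝ
  symm : ∀ s t, u₁ s t = u₂ t s

section Distributions

variable {C : Type*} [MeasurableSpace C]

/-- The joint distribution of a pair, viewed as the matrix of its probability masses. -/
noncomputable def jointMatrix (π : ProbabilityMeasure (C × C)) : Matrix C C ℝ :=
  Matrix.of fun s t => ((π {(s, t)} : NNReal) : ℝ)

/-- The symmetric product distributions `w × w`, i.e. the laws of i.i.d. pairs. -/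
noncomputable def symmetricProducts (C : Type*) [MeasurableSpace C] :
    Set (ProbabilityMeasure (C × C)) :=
  Set.range fun w : ProbabilityMeasure C => w.prod w

/-- `π` is the law of a pair which is i.i.d. conditioned on some hidden variable `Θ`: here `ν` is
the law of `Θ` on some measurable space `E`, and conditioned on `Θ = θ` the two coordinates are
independent with common law `κ θ`. -/
def IsConditionallyIID {C : Type u} [MeasurableSpace C]
    (π : ProbabilityMeasure (C × C)) : Prop :=
  ∃ (E : Type v) (_ : MeasurableSpace E) (ν : Measure E) (κ : Kernel E C),
    IsProbabilityMeasure ν ∧ IsMarkovKernel κ ∧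
      (π : Measure (C × C)) = ν.bind (κ ×ₖ κ)

/-- The law `μ` of an infinite sequence (indexed by `0, 1, 2, …`) is exchangeable: it is invariant
under all permutations of finitely many indices. -/
def IsInftyExchangeable (μ : ProbabilityMeasure (ℕ → C)) : Prop :=
  ∀ σ : Equiv.Perm ℕ, {i | σ i ≠ i}.Finite →
    (μ : Measure (ℕ → C)).map (fun x i => x (σ i)) = μ

/-- The law of the first two coordinates of a random sequence with law `μ`. -/
noncomputable def bivariateMarginal (μ : ProbabilityMeasure (ℕ → C)) :
    ProbabilityMeasure (C × C) :=
  μ.map (f := fun x => (x 0, x 1))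
    ((measurable_pi_apply 0).prodMk (measurable_pi_apply 1)).aemeasurable

end Distributions

namespace SymmetricBimatrixGame

variable {C : Type*} [Fintype C] [MeasurableSpace C]

/-- `π` is a correlated equilibrium: neither player gains in expectation by applying a function
`f : C → C` to her recommended strategy. -/
def IsCorrelatedEquilibrium (Γ : SymmetricBimatrixGame C) (π : ProbabilityMeasure (C × C)) :
    Prop :=
  (∀ f : C → C, ∑ s : C × C,
    (Γ.u₁ (f s.1) s.2 - Γ.u₁ s.1 s.2) * ((π {s} : NNReal) : ℝ) ≤ 0) ∧
  (∀ f : C → C, ∑ s : C × C,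
    (Γ.u₂ s.1 (f s.2) - Γ.u₂ s.1 s.2) * ((π {s} : NNReal) : ℝ) ≤ 0)

/-- `π` is an exchangeable equilibrium: a correlated equilibrium in which the players' actions are
conditionally i.i.d. -/
def IsExchangeableEquilibrium {C : Type u} [Fintype C] [MeasurableSpace C]
    (Γ : SymmetricBimatrixGame C) (π : ProbabilityMeasure (C × C)) : Prop :=
  Γ.IsCorrelatedEquilibrium π ∧ IsConditionallyIID.{u, v} π

/-- The set of correlated equilibria whose matrix lies in the convex hull of the symmetric
product distributions. -/
def exchangeableEquilibria (Γ : SymmetricBimatrixGame C) : Set (ProbabilityMeasure (C × C)) :=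
  {π | Γ.IsCorrelatedEquilibrium π ∧
    jointMatrix π ∈ convexHull ℝ (jointMatrix '' symmetricProducts C)}

/-- `μ` is an `∞`-exchangeable equilibrium: it is exchangeable and the law of its first two
coordinates is a correlated equilibrium. -/
def IsInftyExchangeableEquilibrium (Γ : SymmetricBimatrixGame C)
    (μ : ProbabilityMeasure (ℕ → C)) : Prop :=
  IsInftyExchangeable μ ∧ Γ.IsCorrelatedEquilibrium (bivariateMarginal μ)

end SymmetricBimatrixGame

/-! The equilibrium inequalities involve only the bivariate law, so all three descriptions reduce to
one condition: the matrix of `π` lies in `selfProductHull C`. As `C` is finite, this hull is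
compact, hence closed. A conditionally i.i.d. law is an average of rank-one matrices over the hidden
variable, and averages stay in a closed convex set (`integral_selfProduct_mem_selfProductHull`). For
an exchangeable sequence the full de Finetti theorem is not needed: the expected products of
empirical frequencies lie in the hull and converge to the bivariate marginal. Conversely, a point of
the hull is a finite mixture of products `w × w` (`exists_mixture_of_mem_selfProductHull`). Its
index serves as the hidden variable, and mixing the infinite powers of the `w` gives the
exchangeable sequence. -/

/-- By Carathéodory, `finrank + 1` points suffice, so the hull is a continuous image of a simplex
times a power of `S`. -/
theorem isCompact_convexHull_of_isCompact {E : Type*} [AddCommGroup E] [Module ℝ E]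
    [TopologicalSpace E] [ContinuousAdd E] [ContinuousSMul ℝ E] [FiniteDimensional ℝ E]
    {S : Set E} (hS : IsCompact S) : IsCompact (convexHull ℝ S) := by
  classical
  let d := Module.finrank ℝ E + 1
  have hK : IsCompact ((fun q : (Fin d → ℝ) × (Fin d → E) => ∑ i, q.1 i • q.2 i) ''
      (stdSimplex ℝ (Fin d) ×ˢ Set.univ.pi fun _ : Fin d => S)) :=
    ((isCompact_stdSimplex ℝ (Fin d)).prod (isCompact_univ_pi fun _ => hS)).image (by fun_prop)
  convert hK using 1
  apply Set.Subset.antisymm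
  · intro x hx
    obtain ⟨x₀, hx₀⟩ := convexHull_nonempty_iff.1 ⟨x, hx⟩
    obtain ⟨ι, _, z, w, hz, hind, hw, hsum, rfl⟩ := eq_pos_convex_span_of_mem_convexHull hx
    have hcard : Fintype.card ι ≤ Fintype.card (Fin d) := by
      simpa [d] using hind.card_le_finrank_succ.trans
        (Nat.succ_le_succ (Submodule.finrank_le _))
    obtain ⟨e⟩ := Function.Embedding.nonempty_of_card_le hcard
    -- Fewer than `d` points may occur; the spare slots get weight zero and the filler point `x₀` of
    -- `S`.
    let a : Fin d → ℝ := Function.extend e w fun _ => 0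
    have hval : ∀ i, a (e i) = w i := e.injective.extend_apply w _
    have hzero : ∀ j, j ∉ Set.range e → a j = 0 := fun j hj => Function.extend_apply' w _ j hj
    refine ⟨(a, Function.extend e z fun _ => x₀), ⟨⟨fun j => ?_, ?_⟩, ?_⟩, ?_⟩
    · by_cases hj : j ∈ Set.range e
      · obtain ⟨i, rfl⟩ := hj
        exact (hw i).le.trans_eq (hval i).symm
      · exact (hzero j hj).ge
    · rw [← hsum]
      exact (Fintype.sum_of_injective e e.injective w _ hzero fun i => (hval i).symm).symm
    · intro j _
      by_cases hj : j ∈ Set.range e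
      · obtain ⟨i, rfl⟩ := hj
        simpa [e.injective.extend_apply] using hz ⟨i, rfl⟩
      · simpa [Function.extend_apply' z _ j hj] using hx₀
    · refine (Fintype.sum_of_injective e e.injective _ _ (fun j hj => ?_) fun i => ?_).symm
      · simp [hzero j hj]
      · simp [hval, e.injective.extend_apply]
  · rintro _ ⟨⟨w, z⟩, ⟨⟨hw, hsum⟩, hz⟩, rfl⟩
    exact mem_convexHull_of_exists_fintype w z hw hsum (fun i => hz i trivial) rfl

theorem jointMatrix_apply {C : Type*} [MeasurableSpace C] (π : ProbabilityMeasure (C × C))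
    (s t : C) :
    jointMatrix π s t = (π : Measure (C × C)).real {(s, t)} := rfl

/-! ### Rank-one matrices and their convex hull -/

section SymmetricProducts

variable {C : Type*} [Fintype C]

/-- The rank-one matrix `(p s * p t)`, as a function of two variables. -/
def selfProduct (p : C → ℝ) : C → C → ℝ := fun s t => p s * p t

/-- The convex hull of the rank-one matrices of the points of the standard simplex. -/
def selfProductHull (C : Type*) [Fintype C] : Set (C → C → ℝ) :=
  convexHull ℝ (selfProduct '' stdSimplex ℝ C)

theorem isClosed_selfProductHull : IsClosed (selfProductHull C) := by
  refine (isCompact_convexHull_of_isCompact ?_).isClosed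
  refine (isCompact_stdSimplex ℝ C).image ?_
  unfold selfProduct
  fun_prop

theorem integral_selfProduct_mem_selfProductHull {Ω : Type*} [MeasurableSpace Ω] (ν : Measure Ω)
    [IsProbabilityMeasure ν] (p : Ω → C → ℝ) (hp : ∀ s, Measurable fun ω => p ω s)
    (hmem : ∀ ω, p ω ∈ stdSimplex ℝ C) :
    (fun s t => ∫ ω, p ω s * p ω t ∂ν) ∈ selfProductHull C := by
  have hint : ∀ s t, Integrable (fun ω => p ω s * p ω t) ν := fun s t => by
    refine Integrable.of_bound ((hp s).mul (hp t)).aestronglyMeasurable 1 (ae_of_all _ fun ω => ?_)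
    have h := mem_Icc_of_mem_stdSimplex (hmem ω)
    rw [Real.norm_of_nonneg (mul_nonneg (h s).1 (h t).1)]
    exact mul_le_one₀ (h s).2 (h t).1 (h t).2
  have hint' : ∀ s, Integrable (fun ω => selfProduct (p ω) s) ν := fun s =>
    Integrable.of_eval (hint s)
  have key := (convex_convexHull ℝ (selfProduct '' stdSimplex ℝ C)).integral_mem
    isClosed_selfProductHull
    (ae_of_all ν fun ω => subset_convexHull ℝ _ (Set.mem_image_of_mem _ (hmem ω)))
    (Integrable.of_eval hint')
  change _ ∈ convexHull ℝ (selfProduct '' stdSimplex ℝ C)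
  convert key using 1
  funext s t
  rw [eval_integral hint']
  exact (eval_integral (hint s) t).symm

variable [MeasurableSpace C]

theorem jointMatrix_prod (w : ProbabilityMeasure C) :
    jointMatrix (w.prod w) = Matrix.of (selfProduct fun s => (w : Measure C).real {s}) := by
  ext s t
  rw [jointMatrix_apply, ProbabilityMeasure.toMeasure_prod, ← Set.singleton_prod_singleton,
    measureReal_prod_prod]
  rfl

variable [MeasurableSingletonClass C]

theorem real_singleton_mem_stdSimplex (w : Measure C) [IsProbabilityMeasure w] :
    (fun s => w.real {s}) ∈ stdSimplex ℝ C := by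
  refine ⟨fun _ => measureReal_nonneg, ?_⟩
  simp

theorem exists_probabilityMeasure_of_mem_stdSimplex {p : C → ℝ} (hp : p ∈ stdSimplex ℝ C) :
    ∃ w : ProbabilityMeasure C, ∀ s, (w : Measure C).real {s} = p s := by
  have hsum : ∑ s, ENNReal.ofReal (p s) = 1 := by
    rw [← ENNReal.ofReal_sum_of_nonneg fun s _ => hp.1 s, hp.2, ENNReal.ofReal_one]
  refine ⟨⟨(PMF.ofFintype _ hsum).toMeasure, inferInstance⟩, fun s => ?_⟩
  change ((PMF.ofFintype _ hsum).toMeasure {s}).toReal = p s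
  rw [PMF.toMeasure_apply_singleton _ _ (measurableSet_singleton _), PMF.ofFintype_apply,
    ENNReal.toReal_ofReal (hp.1 s)]

theorem convexHull_symmetricProducts :
    convexHull ℝ (jointMatrix '' symmetricProducts C) = Matrix.of '' selfProductHull C := by
  have h : jointMatrix '' symmetricProducts C =
      Matrix.ofLinearEquiv ℝ '' (selfProduct '' stdSimplex ℝ C) := by
    ext M
    constructor
    · rintro ⟨_, ⟨w, rfl⟩, rfl⟩
      exact ⟨_, ⟨_, real_singleton_mem_stdSimplex (w : Measure C), rfl⟩, (jointMatrix_prod w).symm⟩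
    · rintro ⟨_, ⟨p, hp, rfl⟩, rfl⟩
      obtain ⟨w, hw⟩ := exists_probabilityMeasure_of_mem_stdSimplex hp
      refine ⟨_, ⟨w, rfl⟩, ?_⟩
      simp only [jointMatrix_prod, hw]
      rfl
  rw [h]
  exact ((Matrix.ofLinearEquiv ℝ (m := C) (n := C) (α := ℝ)).toLinearMap.image_convexHull _).symm

theorem jointMatrix_mem_convexHull_iff (π : ProbabilityMeasure (C × C)) :
    jointMatrix π ∈ convexHull ℝ (jointMatrix '' symmetricProducts C) ↔
      (fun s t => (π : Measure (C × C)).real {(s, t)}) ∈ selfProductHull C := by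
  rw [convexHull_symmetricProducts]
  exact Matrix.of.injective.mem_set_image (a := fun s t => (π : Measure (C × C)).real {(s, t)})

end SymmetricProducts

/-! ### From the hull to mixtures of i.i.d. laws -/

theorem map_perm_infinitePi {C : Type*} [MeasurableSpace C] (w : Measure C)
    [IsProbabilityMeasure w] (σ : Equiv.Perm ℕ) :
    (Measure.infinitePi fun _ : ℕ => w).map (fun x i => x (σ i)) =
      Measure.infinitePi fun _ => w := by
  convert Measure.infinitePi_map_piCongrLeft (fun _ : ℕ => w) σ.symm using 2
  ext x i
  simp [MeasurableEquiv.coe_piCongrLeft, Equiv.piCongrLeft_apply]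

section FiniteMixture

variable {C : Type u} [Fintype C] [MeasurableSpace C] [MeasurableSingletonClass C]
  {π : ProbabilityMeasure (C × C)}

theorem exists_mixture_of_mem_selfProductHull
    (h : (fun s t => (π : Measure (C × C)).real {(s, t)}) ∈ selfProductHull C) :
    ∃ (ι : Type) (_ : Fintype ι) (p : PMF ι) (w : ι → ProbabilityMeasure C),
      ∀ s t, (π : Measure (C × C)) {(s, t)} =
        ∑ i, (w i : Measure C) {s} * (w i : Measure C) {t} * p i := by
  obtain ⟨ι, _, a, z, ha, hsum, hz, hx⟩ := mem_convexHull_iff_exists_fintype.1 h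
  choose q hq hqz using hz
  choose w hw using fun i => exists_probabilityMeasure_of_mem_stdSimplex (hq i)
  have hsum' : ∑ i, ENNReal.ofReal (a i) = 1 := by
    rw [← ENNReal.ofReal_sum_of_nonneg fun i _ => ha i, hsum, ENNReal.ofReal_one]
  refine ⟨ι, inferInstance, PMF.ofFintype _ hsum', w, fun s t => ?_⟩
  have hst := congrFun (congrFun hx s) t
  simp only [Finset.sum_apply, Pi.smul_apply, smul_eq_mul, ← hqz, selfProduct, ← hw] at hst
  rw [← ofReal_measureReal, ← hst, ENNReal.ofReal_sum_of_nonneg fun i _ => by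
    have := ha i; positivity]
  refine Finset.sum_congr rfl fun i _ => ?_
  rw [ENNReal.ofReal_mul (ha i), ENNReal.ofReal_mul measureReal_nonneg, ofReal_measureReal,
    ofReal_measureReal, mul_comm, PMF.ofFintype_apply]

theorem isConditionallyIID_of_mem_selfProductHull
    (h : (fun s t => (π : Measure (C × C)).real {(s, t)}) ∈ selfProductHull C) :
    IsConditionallyIID.{u, v} π := by
  obtain ⟨ι, _, p, w, hπ⟩ := exists_mixture_of_mem_selfProductHull h
  let _ : MeasurableSpace ι := ⊤
  -- `ULift` moves the finite index type to the universe prescribed for the hidden variable.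
  let κ : Kernel (ULift.{v} ι) C :=
    ⟨fun i => (w i.down : Measure C), (measurable_from_top (f := fun i => (w i : Measure C))).comp
      measurable_down⟩
  have hκ : IsMarkovKernel κ := ⟨fun i => (w i.down).2⟩
  refine ⟨ULift.{v} ι, inferInstance, p.toMeasure.map ULift.up, κ,
    Measure.isProbabilityMeasure_map measurable_up.aemeasurable, hκ, ?_⟩
  refine Measure.ext_of_singleton fun ⟨s, t⟩ => ?_
  rw [Measure.bind_apply (measurableSet_singleton _) (Kernel.aemeasurable _),
    lintegral_map (Kernel.measurable_coe _ (measurableSet_singleton _)) measurable_up,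
    lintegral_fintype, hπ]
  simp only [← Set.singleton_prod_singleton, Kernel.prod_apply_prod,
    PMF.toMeasure_apply_singleton _ _ (measurableSet_singleton _)]
  rfl

theorem exists_isInftyExchangeable_of_mem_selfProductHull
    (h : (fun s t => (π : Measure (C × C)).real {(s, t)}) ∈ selfProductHull C) :
    ∃ μ : ProbabilityMeasure (ℕ → C), IsInftyExchangeable μ ∧ bivariateMarginal μ = π := by
  obtain ⟨ι, _, p, w, hπ⟩ := exists_mixture_of_mem_selfProductHull h
  let _ : MeasurableSpace ι := ⊤
  let κ : Kernel ι (ℕ → C) :=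
    ⟨fun i => Measure.infinitePi fun _ => (w i : Measure C), measurable_from_top⟩
  have hκ : IsMarkovKernel κ := ⟨fun i =>
    inferInstanceAs (IsProbabilityMeasure (Measure.infinitePi fun _ => (w i : Measure C)))⟩
  refine ⟨⟨p.toMeasure.bind κ, inferInstance⟩, fun σ _ => ?_, ?_⟩
  · have hσ : Measurable fun (x : ℕ → C) i => x (σ i) := by fun_prop
    ext A hA
    rw [Measure.map_apply hσ hA]
    change p.toMeasure.bind κ _ = p.toMeasure.bind κ A
    rw [Measure.bind_apply (hσ hA) κ.aemeasurable, Measure.bind_apply hA κ.aemeasurable]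
    refine lintegral_congr fun i => ?_
    rw [← Measure.map_apply hσ hA]
    exact congrArg (· A) (map_perm_infinitePi (w i : Measure C) σ)
  · refine Subtype.ext (Measure.ext_of_singleton fun ⟨s, t⟩ => ?_)
    have hm : Measurable fun x : ℕ → C => (x 0, x 1) := by fun_prop
    change (p.toMeasure.bind κ).map (fun x => (x 0, x 1)) {(s, t)} = (π : Measure (C × C)) {(s, t)}
    rw [Measure.map_apply hm (measurableSet_singleton _),
      Measure.bind_apply (hm (measurableSet_singleton _)) κ.aemeasurable, lintegral_fintype, hπ]
    refine Finset.sum_congr rfl fun i _ => ?_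
    rw [PMF.toMeasure_apply_singleton _ _ (measurableSet_singleton _)]
    congr 1
    -- As a box over the coordinates `0` and `1`, the event has a product formula under
    -- `Measure.infinitePi`.
    have hset : (fun x : ℕ → C => (x 0, x 1)) ⁻¹' {(s, t)} =
        Set.pi (Finset.range 2) fun n => if n = 0 then {s} else {t} := by
      ext x
      simp [Finset.range_add_one, and_comm]
    rw [hset]
    change Measure.infinitePi (fun _ => (w i : Measure C)) _ = _
    rw [Measure.infinitePi_pi _ fun n _ => by split_ifs <;> exact measurableSet_singleton _]
    simp [Finset.prod_range_succ]

end FiniteMixture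

/-! ### Pair marginals and empirical frequencies of sequences -/

theorem exists_perm_apply_zero_one {i j : ℕ} (hij : i ≠ j) :
    ∃ σ : Equiv.Perm ℕ, {k | σ k ≠ k}.Finite ∧ σ 0 = i ∧ σ 1 = j := by
  let τ := Equiv.swap 0 i
  have hτ : τ j ≠ 0 := by
    intro h
    have : j = τ 0 := by rw [← h]; exact (Equiv.swap_apply_self 0 i j).symm
    exact hij (by rw [this, Equiv.swap_apply_left])
  -- The right factor acts first: it fixes `0` because `τ j ≠ 0`, and sends `1` to `τ j`, which the
  -- involution `τ` returns to `j`.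
  refine ⟨τ * Equiv.swap 1 (τ j), ?_, ?_, ?_⟩
  · refine (Set.toFinite ({0, i, 1, τ j} : Set ℕ)).subset fun k hk => ?_
    by_contra hk'
    simp only [Set.mem_insert_iff, Set.mem_singleton_iff, not_or] at hk'
    refine hk ?_
    rw [Equiv.Perm.mul_apply, Equiv.swap_apply_of_ne_of_ne hk'.2.2.1 hk'.2.2.2,
      Equiv.swap_apply_of_ne_of_ne hk'.1 hk'.2.1]
  · rw [Equiv.Perm.mul_apply, Equiv.swap_apply_of_ne_of_ne zero_ne_one hτ.symm,
      Equiv.swap_apply_left]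
  · rw [Equiv.Perm.mul_apply, Equiv.swap_apply_left]
    exact Equiv.swap_apply_self 0 i j

theorem IsInftyExchangeable.map_pair {C : Type*} [MeasurableSpace C]
    {μ : ProbabilityMeasure (ℕ → C)}
    (hμ : IsInftyExchangeable μ) {i j : ℕ} (hij : i ≠ j) :
    (μ : Measure (ℕ → C)).map (fun x => (x i, x j)) = bivariateMarginal μ := by
  obtain ⟨σ, hσ, rfl, rfl⟩ := exists_perm_apply_zero_one hij
  change _ = (μ : Measure (ℕ → C)).map (fun x => (x 0, x 1))
  conv_rhs => rw [← hμ σ hσ]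
  rw [Measure.map_map (by fun_prop) (by fun_prop)]
  rfl

open scoped Classical in
/-- The frequency of `s` among the first `n + 1` terms of `x`. -/
noncomputable def empiricalFrequency {C : Type*} (n : ℕ) (x : ℕ → C) (s : C) : ℝ :=
  (∑ i ∈ Finset.range (n + 1), if x i = s then 1 else 0) / (n + 1)

theorem empiricalFrequency_mem_stdSimplex {C : Type*} [Fintype C] (n : ℕ) (x : ℕ → C) :
    empiricalFrequency n x ∈ stdSimplex ℝ C := by
  refine ⟨fun s => ?_, ?_⟩
  · unfold empiricalFrequency
    positivity
  · classical
    unfold empiricalFrequency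
    rw [← Finset.sum_div, Finset.sum_comm]
    simp only [Finset.sum_ite_eq, Finset.mem_univ, if_true, Finset.sum_const, Finset.card_range,
      nsmul_eq_mul, mul_one]
    push_cast
    exact div_self (by positivity)

/-! ### From hidden variables and exchangeability to the hull -/

section DeFinetti

variable {C : Type u} [Fintype C] [MeasurableSpace C] [MeasurableSingletonClass C]

theorem IsConditionallyIID.mem_selfProductHull {π : ProbabilityMeasure (C × C)}
    (h : IsConditionallyIID.{u, v} π) :
    (fun s t => (π : Measure (C × C)).real {(s, t)}) ∈ selfProductHull C := by
  obtain ⟨E, _, ν, κ, _, _, hπ⟩ := h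
  convert integral_selfProduct_mem_selfProductHull ν (fun θ s => (κ θ).real {s})
    (fun s => (κ.measurable_coe (measurableSet_singleton s)).ennreal_toReal)
    (fun θ => real_singleton_mem_stdSimplex (κ θ)) using 3 with s t
  rw [Measure.real, hπ, Measure.bind_apply (measurableSet_singleton _) (Kernel.aemeasurable _),
    ← integral_toReal (Kernel.measurable_coe _ (measurableSet_singleton _)).aemeasurable
      (ae_of_all _ fun _ => measure_lt_top _ _)]
  simp only [← Set.singleton_prod_singleton, Kernel.prod_apply_prod, ENNReal.toReal_mul]
  rfl

theorem measurable_empiricalFrequency (n : ℕ) (s : C) :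
    Measurable fun x : ℕ → C => empiricalFrequency n x s := by
  unfold empiricalFrequency
  refine (Finset.measurable_sum _ fun i _ => ?_).div_const _
  exact Measurable.ite (measurableSet_eq_fun (measurable_pi_apply i) measurable_const)
    measurable_const measurable_const

theorem integral_empiricalFrequency_mul (μ : Measure (ℕ → C)) [IsProbabilityMeasure μ] (n : ℕ)
    (s t : C) :
    ∫ x, empiricalFrequency n x s * empiricalFrequency n x t ∂μ =
      (∑ i ∈ Finset.range (n + 1), ∑ j ∈ Finset.range (n + 1),
        (μ.map fun x => (x i, x j)).real {(s, t)}) / (n + 1) ^ 2 := by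
  classical
  have hm : ∀ i j, MeasurableSet {x : ℕ → C | x i = s ∧ x j = t} := fun i j =>
    (measurableSet_eq_fun (measurable_pi_apply i) measurable_const).inter
      (measurableSet_eq_fun (measurable_pi_apply j) measurable_const)
  have h : ∀ x : ℕ → C, empiricalFrequency n x s * empiricalFrequency n x t =
      (∑ i ∈ Finset.range (n + 1), ∑ j ∈ Finset.range (n + 1),
        {x : ℕ → C | x i = s ∧ x j = t}.indicator (fun _ => (1 : ℝ)) x) / (n + 1) ^ 2 := fun x => by
    simp only [empiricalFrequency, div_mul_div_comm, Finset.sum_mul_sum, ← pow_two,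
      Set.indicator_apply, Set.mem_ofPred_eq, ite_and, ite_mul, one_mul, zero_mul]
  have hint : ∀ i j, Integrable ({x : ℕ → C | x i = s ∧ x j = t}.indicator fun _ => (1 : ℝ)) μ :=
    fun i j => (integrable_const 1).indicator (hm i j)
  simp only [h]
  rw [integral_div, integral_finsetSum _ fun i _ => integrable_finsetSum _ fun j _ => hint i j]
  congr 1
  refine Finset.sum_congr rfl fun i _ => ?_
  rw [integral_finsetSum _ fun j _ => hint i j]
  refine Finset.sum_congr rfl fun j _ => ?_
  rw [integral_indicator_const _ (hm i j), smul_eq_mul, mul_one,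
    map_measureReal_apply (by fun_prop) (measurableSet_singleton _)]
  congr 1
  ext x
  simp

/-- The integral averages the laws of `(x i, x j)` over `(n + 1) ^ 2` index pairs. Off the diagonal
each equals the bivariate marginal; the `n + 1` diagonal pairs err by at most `1` each. -/
theorem IsInftyExchangeable.abs_integral_empiricalFrequency_mul_sub_le
    {μ : ProbabilityMeasure (ℕ → C)} (hμ : IsInftyExchangeable μ) (n : ℕ) (s t : C) :
    |∫ x, empiricalFrequency n x s * empiricalFrequency n x t ∂(μ : Measure (ℕ → C)) -
      (bivariateMarginal μ : Measure (C × C)).real {(s, t)}| ≤ 1 / ((n : ℝ) + 1) := by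
  set b := (bivariateMarginal μ : Measure (C × C)).real {(s, t)} with hb
  let a : ℕ → ℕ → ℝ := fun i j =>
    ((μ : Measure (ℕ → C)).map fun x => (x i, x j)).real {(s, t)}
  have ha : ∀ i j, |a i j - b| ≤ if i = j then 1 else 0 := fun i j => by
    split_ifs with hij
    · have : IsProbabilityMeasure ((μ : Measure (ℕ → C)).map fun x => (x i, x j)) :=
        Measure.isProbabilityMeasure_map (by fun_prop)
      have h₀ : 0 ≤ a i j := measureReal_nonneg
      have h₁ : a i j ≤ 1 := measureReal_le_one
      have h₂ : 0 ≤ b := measureReal_nonneg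
      have h₃ : b ≤ 1 := measureReal_le_one
      exact abs_sub_le_iff.2 ⟨by linarith, by linarith⟩
    · simp [a, hb, hμ.map_pair hij]
  have hn : (0 : ℝ) < n + 1 := by positivity
  have hsum : |∑ i ∈ Finset.range (n + 1), ∑ j ∈ Finset.range (n + 1), (a i j - b)| ≤ n + 1 := by
    refine (Finset.abs_sum_le_sum_abs _ _).trans ((Finset.sum_le_sum fun i _ =>
      (Finset.abs_sum_le_sum_abs _ _).trans (Finset.sum_le_sum fun j _ => ha i j)).trans ?_)
    refine (Finset.sum_le_sum (g := fun _ => (1 : ℝ)) fun i hi => ?_).trans (by simp)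
    rw [Finset.sum_ite_eq, if_pos hi]
  have heq : (∑ i ∈ Finset.range (n + 1), ∑ j ∈ Finset.range (n + 1), a i j) / ((n : ℝ) + 1) ^ 2 - b
      = (∑ i ∈ Finset.range (n + 1), ∑ j ∈ Finset.range (n + 1), (a i j - b)) /
        ((n : ℝ) + 1) ^ 2 := by
    simp only [Finset.sum_sub_distrib, Finset.sum_const, Finset.card_range, nsmul_eq_mul]
    push_cast
    field_simp
  rw [integral_empiricalFrequency_mul, heq, abs_div, abs_of_pos (pow_pos hn 2),
    div_le_div_iff₀ (pow_pos hn 2) hn]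
  nlinarith

theorem IsInftyExchangeable.mem_selfProductHull {μ : ProbabilityMeasure (ℕ → C)}
    (hμ : IsInftyExchangeable μ) :
    (fun s t => (bivariateMarginal μ : Measure (C × C)).real {(s, t)}) ∈ selfProductHull C := by
  refine isClosed_selfProductHull.mem_of_tendsto (b := Filter.atTop) ?_
    (Filter.Eventually.of_forall fun n => integral_selfProduct_mem_selfProductHull
      (μ : Measure (ℕ → C)) (empiricalFrequency n) (measurable_empiricalFrequency n)
      (empiricalFrequency_mem_stdSimplex n))
  rw [tendsto_pi_nhds]
  intro s
  rw [tendsto_pi_nhds]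
  intro t
  rw [tendsto_iff_dist_tendsto_zero]
  exact squeeze_zero (fun _ => dist_nonneg)
    (fun n => hμ.abs_integral_empiricalFrequency_mul_sub_le n s t)
    tendsto_one_div_add_atTop_nhds_zero_nat

end DeFinetti

theorem corollary4p6 {C : Type u} [Fintype C] [MeasurableSpace C]
    [MeasurableSingletonClass C] (Γ : SymmetricBimatrixGame C)
    (π : ProbabilityMeasure (C × C)) :
    (Γ.IsExchangeableEquilibrium.{u, v} π ↔
      ∃ μ : ProbabilityMeasure (ℕ → C),
        Γ.IsInftyExchangeableEquilibrium μ ∧ bivariateMarginal μ = π) ∧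
    (π ∈ Γ.exchangeableEquilibria ↔
      ∃ μ : ProbabilityMeasure (ℕ → C),
        Γ.IsInftyExchangeableEquilibrium μ ∧ bivariateMarginal μ = π) := by
  have hinf : (∃ μ : ProbabilityMeasure (ℕ → C),
        Γ.IsInftyExchangeableEquilibrium μ ∧ bivariateMarginal μ = π) ↔
      Γ.IsCorrelatedEquilibrium π ∧
        (fun s t => (π : Measure (C × C)).real {(s, t)}) ∈ selfProductHull C := by
    constructor
    · rintro ⟨μ, ⟨hμ, hce⟩, rfl⟩
      exact ⟨hce, hμ.mem_selfProductHull⟩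
    · rintro ⟨hce, h⟩
      obtain ⟨μ, hμ, rfl⟩ := exists_isInftyExchangeable_of_mem_selfProductHull h
      exact ⟨μ, ⟨hμ, hce⟩, rfl⟩
  rw [hinf]
  exact ⟨and_congr_right fun _ => ⟨fun h => h.mem_selfProductHull,
    isConditionallyIID_of_mem_selfProductHull⟩,
    and_congr_right fun _ => jointMatrix_mem_convexHull_iff π⟩
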